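/- For a subset $B$ of a set $X$ and a family $\mathcal U$ of subsets of $X$, let $\mathrm{st}(B,\mathcal U)$ be the union of the members of $\mathcal U$ that intersect $B$, and for a family $\mathcal B$ let $\mathrm{st}(\mathcal B,\mathcal U)=\{\mathrm{st}(B,\mathcal U) : B\in\mathcal B\}$. A *large scale structure* on $X$ is a nonempty collection $\mathcal L$ of families of subsets of $X$ (the *uniformly bounded* families) such that (1) if $\mathcal B_1\in\mathcal L$ and every element of $\mathcal B_2$ with more than one point is contained in some element of $\mathcal B_1$, then $\mathcal B_2\in\mathcal L$; (2) if $\mathcal B_1,\mathcal B_2\in\mathcal L$, then $\mathrm{st}(\mathcal B_1,\mathcal B_2)\in\mathcal L$. A *hybrid large scale space* (hls-space) is a set $X$ with a topology and a large scale structure such that some uniformly bounded cover of $X$ consists of open sets. A subset of $X$ is *bounded* if it is a member of some uniformly bounded cover; the *coarse component* of $x \in X$ is the union of all bounded sets containing $x$; a set is *weakly bounded* if its intersection with every coarse component is bounded. A map $f:X\to M$ to a metric space is *slowly oscillating* if for every uniformly bounded family $\mathcal U$ and every $\varepsilon>0$ there is a weakly bounded set $K$ such that $\mathrm{diam}\,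 f(U)<\varepsilon$ for all $U\in\mathcal U$ with $U\cap K=\varnothing$. Subsets $A,B$ of $X$ are *coarsely separated* if $\mathrm{st}(A,\mathcal U)\cap \mathrm{st}(B,\mathcal U)$ is weakly bounded for every uniformly bounded family $\mathcal U$. A set $N$ is a *hybrid neighbourhood* of $A$ if $N$ contains an open set containing the closure of $A$, and for every uniformly bounded cover $\mathcal U$ there is a weakly bounded set $K$ with $\mathrm{st}(A,\mathcal U)\subseteq N\cup K$. The hls-space $X$ is *hls-normal* if for every closed set $A$ and every hybrid neighbourhood $N$ of $A$ there is a closed set $V$ such that $V$ is a hybrid neighbourhood of $A$ and $N$ is a hybrid neighbourhood of $V$. If the topology of $X$ is Tychonoff, the *Higson compactification* $h(X)$ is the compactification of $X$ determined by the set $S$ of continuous slowly oscillating functions $X\to[0,1]$, i.e. the closure of the image of $X$ under the evaluation embedding $X\to[0,1]^{S}$, $x\mapsto (f(x))_{f\in S}$. **Proposition.** Let $X$ be an hls-space whose topology is Tychonoff (completely regular and Hausdorff). For $Y\subseteq X$ let $\overline Y$ denote the closure of $Y$ in $h(X)$. Then the following are equivalent: 1. $X$ is hls-normal; 2. for any two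 disjoint closed subsets $A$ and $B$ of $X$, $A$ and $B$ are coarsely separated if and only if $\overline A\cap\overline B=\varnothing$. -/

import Mathlib

open Set Topology

/-- The star of `B` with respect to the family `𝒰`: the union of those members of `𝒰` that
intersect `B`. -/
def starOf {X : Type*} (B : Set X) (𝒰 : Set (Set X)) : Set X :=
  ⋃₀ {U | U ∈ 𝒰 ∧ (U ∩ B).Nonempty}

/-- The star of a family `ℬ` with respect to the family `𝒰`: the family of the stars of the
members of `ℬ`. -/
def starFamily {X : Type*} (ℬ 𝒰 : Set (Set X)) : Set (Set X) :=
  (fun B => starOf B 𝒰) '' ℬ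

/-- A large scale structure on `X`: a nonempty collection of families of subsets of `X`, the
uniformly bounded families (scales). -/
class LsSpace (X : Type*) where
  /-- The uniformly bounded families. -/
  scales : Set (Set (Set X))
  scales_nonempty : scales.Nonempty
  refine_mem : ∀ ℬ₁ ∈ scales, ∀ ℬ₂ : Set (Set X),
    (∀ B ∈ ℬ₂, B.Nontrivial → ∃ C ∈ ℬ₁, B ⊆ C) → ℬ₂ ∈ scales
  star_mem : ∀ ℬ₁ ∈ scales, ∀ ℬ₂ ∈ scales, starFamily ℬ₁ ℬ₂ ∈ scales

/-- A family of subsets of an ls-space is uniformly bounded. -/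
def UniformlyBounded {X : Type*} [LsSpace X] (𝒰 : Set (Set X)) : Prop :=
  𝒰 ∈ LsSpace.scales (X := X)

/-- The family `𝒰` covers `X`. -/
def IsCoverOf {X : Type*} (𝒰 : Set (Set X)) : Prop := ⋃₀ 𝒰 = univ

/-- A hybrid large scale space: a topology and a large scale structure such that some
uniformly bounded cover consists of open sets. -/
class HlsSpace (X : Type*) [TopologicalSpace X] [LsSpace X] : Prop where
  exists_open_scale : ∃ 𝒰 : Set (Set X), UniformlyBounded 𝒰 ∧ IsCoverOf 𝒰 ∧ ∀ U ∈ 𝒰, IsOpen U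

section LargeScale

variable {X : Type*} [LsSpace X]

/-- A set is bounded if it is a member of some uniformly bounded cover. -/
def LsBounded (K : Set X) : Prop :=
  ∃ 𝒰 : Set (Set X), UniformlyBounded 𝒰 ∧ IsCoverOf 𝒰 ∧ K ∈ 𝒰

/-- The coarse component of a point: the union of all bounded sets containing it. -/
def coarseComponent (x : X) : Set X := ⋃₀ {K | LsBounded K ∧ x ∈ K}

/-- A set is weakly bounded if its intersection with any coarse component is bounded. -/
def WeaklyBounded (K : Set X) : Prop := ∀ x : X, LsBounded (K ∩ coarseComponent x)

/-- Slowly oscillating maps to a metric space. The diameter is the extended one, so that the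
inequality includes the boundedness of the image. -/
def SlowlyOscillating {M : Type*} [MetricSpace M] (f : X → M) : Prop :=
  ∀ 𝒰 : Set (Set X), UniformlyBounded 𝒰 → ∀ ε : ℝ, 0 < ε →
    ∃ K : Set X, WeaklyBounded K ∧
      ∀ U ∈ 𝒰, U ∩ K = ∅ → Metric.ediam (f '' U) < ENNReal.ofReal ε

/-- Coarsely separated subsets of an ls-space. -/
def CoarselySeparated (A B : Set X) : Prop :=
  ∀ 𝒰 : Set (Set X), UniformlyBounded 𝒰 → WeaklyBounded (starOf A 𝒰 ∩ starOf B 𝒰)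

/-- `N` is a coarse neighbourhood of `A`. -/
def CoarseNhd (A N : Set X) : Prop :=
  A ⊆ N ∧ ∀ 𝒰 : Set (Set X), UniformlyBounded 𝒰 → IsCoverOf 𝒰 →
    ∃ K : Set X, WeaklyBounded K ∧ starOf A 𝒰 ⊆ N ∪ K

end LargeScale

/-- `N` is a topological neighbourhood of `A`: it contains an open set containing the closure
of `A`. -/
def TopNhd {X : Type*} [TopologicalSpace X] (A N : Set X) : Prop :=
  ∃ O : Set X, IsOpen O ∧ closure A ⊆ O ∧ O ⊆ N

/-- `N` is a hybrid neighbourhood of `A`. -/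
def HybridNhd {X : Type*} [TopologicalSpace X] [LsSpace X] (A N : Set X) : Prop :=
  TopNhd A N ∧ CoarseNhd A N

/-- Hybrid large scale normality. -/
def HlsNormal (X : Type*) [TopologicalSpace X] [LsSpace X] : Prop :=
  ∀ A N : Set X, IsClosed A → HybridNhd A N →
    ∃ V : Set X, IsClosed V ∧ HybridNhd A V ∧ HybridNhd V N

/-- The continuous slowly oscillating functions `X → [0,1]`. -/
def HigsonFun (X : Type*) [TopologicalSpace X] [LsSpace X] : Type _ :=
  {f : X → unitInterval // Continuous f ∧ SlowlyOscillating f}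

/-- The evaluation map of `X` into the cube indexed by all continuous slowly oscillating
functions `X → [0,1]`. -/
def higsonEval (X : Type*) [TopologicalSpace X] [LsSpace X] (x : X) :
    HigsonFun X → unitInterval :=
  fun f => f.1 x

/-- The Higson compactification: the compactification determined by the continuous slowly
oscillating functions `X → [0,1]`, that is, the closure of the image of `X` in the cube indexed
by these functions, with the subspace topology. -/
abbrev HigsonCompactification (X : Type*) [TopologicalSpace X] [LsSpace X] : Type _ :=
  closure (range (higsonEval X))

/-- The canonical map from `X` to its Higson compactification. -/
def toHigson {X : Type*} [TopologicalSpace X] [LsSpace X] (x : X) : HigsonCompactification X :=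
  ⟨higsonEval X x, subset_closure (mem_range_self x)⟩

instance instCompactSpaceHigson (X : Type*) [TopologicalSpace X] [LsSpace X] :
    CompactSpace (HigsonCompactification X) :=
  isCompact_iff_compactSpace.mp isClosed_closure.isCompact

/-- Subsets of bounded sets are bounded. -/
theorem LsBounded.mono {X : Type*} [LsSpace X] {K L : Set X} (hL : LsBounded L) (h : K ⊆ L) :
    LsBounded K := by
  obtain ⟨𝒰, h1, h2, h3⟩ := hL
  refine ⟨insert K 𝒰, LsSpace.refine_mem 𝒰 h1 _ ?_, ?_, mem_insert _ _⟩
  · rintro B (rfl | hB) -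
    · exact ⟨L, h3, h⟩
    · exact ⟨B, hB, Subset.rfl⟩
  · rw [IsCoverOf, sUnion_insert, show ⋃₀ 𝒰 = univ from h2, union_univ]

/-- The image of `X` in the Higson compactification is dense. -/
theorem denseRange_toHigson (X : Type*) [TopologicalSpace X] [LsSpace X] :
    DenseRange (toHigson (X := X)) := by
  rintro ⟨y, hy⟩
  rw [closure_subtype]
  convert hy using 2
  rw [← range_comp]
  rfl

/-- For a Tychonoff hls-space, the canonical map to the Higson compactification is an
embedding. -/
theorem isEmbedding_toHigson (X : Type*) [TopologicalSpace X] [T35Space X] [LsSpace X]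
    [HlsSpace X] : IsEmbedding (toHigson (X := X)) := by
  have hc : Continuous (toHigson (X := X)) :=
    Continuous.subtype_mk (continuous_pi fun f => f.2.1) _
  refine IsInducing.isEmbedding (isInducing_iff_nhds.2 fun x =>
    le_antisymm (hc.tendsto x).le_comap ?_)
  intro s hs
  obtain ⟨t, hts, ht, hxt⟩ := mem_nhds_iff.1 hs
  obtain ⟨𝒰, h𝒰, hcov, hopen⟩ := HlsSpace.exists_open_scale (X := X)
  obtain ⟨U, hU, hxU⟩ : x ∈ ⋃₀ 𝒰 := by rw [show ⋃₀ 𝒰 = univ from hcov]; trivial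
  obtain ⟨f, hf, hfx, hf1⟩ := CompletelyRegularSpace.completely_regular_isOpen x (t ∩ U)
    (ht.inter (hopen U hU)) ⟨hxt, hxU⟩
  have hso : SlowlyOscillating f := by
    intro 𝒱 _ ε hε
    refine ⟨U, fun y => LsBounded.mono ⟨𝒰, h𝒰, hcov, hU⟩ inter_subset_left, fun V _ hVU => ?_⟩
    have : (f '' V).Subsingleton := by
      have key : ∀ z ∈ V, f z = 1 := fun z hz => hf1 fun hz' => by
        have : z ∈ V ∩ U := ⟨hz, hz'.2⟩
        rw [hVU] at this
        exact this
      rintro _ ⟨a, ha, rfl⟩ _ ⟨b, hb, rfl⟩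
      rw [key a ha, key b hb]
    rw [Metric.ediam_subsingleton this]
    exact ENNReal.ofReal_pos.2 hε
  let F : HigsonFun X := ⟨f, hf, hso⟩
  refine Filter.mem_comap.2 ⟨{y | y.1 F ≠ 1}, ?_, fun z hz => hts ?_⟩
  · refine IsOpen.mem_nhds ?_ ?_
    · exact isOpen_ne_fun ((continuous_apply F).comp continuous_subtype_val) continuous_const
    · change f x ≠ 1
      rw [hfx]
      exact zero_ne_one
  · by_contra hzt
    exact hz (hf1 fun h => hzt h.1)

/-! ### Stars of sets and of covers. -/

section Stars

variable {X : Type*}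

/-! Everything passes through Urysohn functions: continuous slowly oscillating `f` with `f = 0` on
`A` and `f = 1` on `B`. Such an `f` forces coarse separation. If it is `[0,1]`-valued, it is a
coordinate of the cube, hence separates the closures. Conversely, disjoint closures are separated by
a continuous function on the compact Hausdorff space `h(X)`, whose pullback is slowly oscillating
because it is uniformly continuous (`slowlyOscillating_comp_toHigson`).

Hls-normality supplies these functions: Urysohn's dyadic construction is run with `CoarseNhd` as the
relation preserved at each step, and the limit is slowly oscillating
(`Urysohns.CU.slowlyOscillating_lim`). In return, the level set `f ≤ 1/2` interpolates between a
closed set and its hybrid neighbourhood. -/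

theorem mem_starOf {A : Set X} {𝒰 : Set (Set X)} {x : X} :
    x ∈ starOf A 𝒰 ↔ ∃ U ∈ 𝒰, x ∈ U ∧ ∃ a ∈ A, a ∈ U := by
  constructor
  · rintro ⟨U, ⟨hU, a, haU, haA⟩, hx⟩
    exact ⟨U, hU, hx, a, haA, haU⟩
  · rintro ⟨U, hU, hx, a, haA, haU⟩
    exact ⟨U, ⟨hU, a, haU, haA⟩, hx⟩

theorem starOf_mono {A B : Set X} {𝒰 𝒱 : Set (Set X)} (hA : A ⊆ B) (h : 𝒰 ⊆ 𝒱) :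
    starOf A 𝒰 ⊆ starOf B 𝒱 := by
  intro x hx
  obtain ⟨U, hU, hxU, a, ha, haU⟩ := mem_starOf.1 hx
  exact mem_starOf.2 ⟨U, h hU, hxU, a, hA ha, haU⟩

theorem IsCoverOf.subset_starOf {𝒰 : Set (Set X)} (h : IsCoverOf 𝒰) (A : Set X) :
    A ⊆ starOf A 𝒰 := by
  intro x hx
  obtain ⟨U, hU, hxU⟩ : x ∈ ⋃₀ 𝒰 := h ▸ mem_univ x
  exact mem_starOf.2 ⟨U, hU, hxU, x, hx, hxU⟩

theorem starOf_starOf_subset {𝒱 : Set (Set X)} (h : IsCoverOf 𝒱) (A : Set X) (𝒰 : Set (Set X)) :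
    starOf (starOf A 𝒰) 𝒱 ⊆ starOf A (starFamily 𝒰 𝒱) := by
  intro x hx
  obtain ⟨V, hV, hxV, y, hy, hyV⟩ := mem_starOf.1 hx
  obtain ⟨U, hU, hyU, a, ha, haU⟩ := mem_starOf.1 hy
  exact mem_starOf.2 ⟨starOf U 𝒱, ⟨U, hU, rfl⟩, mem_starOf.2 ⟨V, hV, hxV, y, hyU, hyV⟩, a, ha,
    h.subset_starOf U haU⟩

theorem IsCoverOf.starFamily {𝒰 𝒱 : Set (Set X)} (hU : IsCoverOf 𝒰) (hV : IsCoverOf 𝒱) :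
    IsCoverOf (starFamily 𝒰 𝒱) := by
  refine eq_univ_of_forall fun x => ?_
  obtain ⟨U, hU', hxU⟩ : x ∈ ⋃₀ 𝒰 := hU ▸ mem_univ x
  exact ⟨starOf U 𝒱, ⟨U, hU', rfl⟩, hV.subset_starOf U hxU⟩

variable [TopologicalSpace X]

theorem closure_subset_starOf {𝒰 : Set (Set X)} (h : IsCoverOf 𝒰) (ho : ∀ U ∈ 𝒰, IsOpen U)
    (A : Set X) : closure A ⊆ starOf A 𝒰 := by
  intro x hx
  obtain ⟨U, hU, hxU⟩ : x ∈ ⋃₀ 𝒰 := h ▸ mem_univ x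
  obtain ⟨a, haU, haA⟩ := mem_closure_iff.1 hx U (ho U hU) hxU
  exact mem_starOf.2 ⟨U, hU, hxU, a, haA, haU⟩

theorem TopNhd.closure_subset_interior {A N : Set X} (h : TopNhd A N) :
    closure A ⊆ interior N := by
  obtain ⟨O, hO, hA, hN⟩ := h
  exact hA.trans (interior_maximal hN hO)

end Stars

/-! ### Weakly bounded sets, coarse neighbourhoods and slow oscillation. -/

section LargeScaleLemmas

variable {X : Type*} [LsSpace X]

/-- Singletons can be adjoined freely, since the refinement axiom ignores sets with at most one
point. -/
theorem UniformlyBounded.exists_cover {𝒰 : Set (Set X)} (h : UniformlyBounded 𝒰) :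
    ∃ 𝒱 : Set (Set X), UniformlyBounded 𝒱 ∧ IsCoverOf 𝒱 ∧ 𝒰 ⊆ 𝒱 := by
  refine ⟨𝒰 ∪ range fun x => {x}, LsSpace.refine_mem 𝒰 h _ ?_, ?_, subset_union_left⟩
  · rintro B (hB | ⟨x, rfl⟩) hn
    · exact ⟨B, hB, Subset.rfl⟩
    · exact absurd hn not_nontrivial_singleton
  · exact eq_univ_of_forall fun x => ⟨{x}, Or.inr ⟨x, rfl⟩, rfl⟩

theorem lsBounded_iff_uniformlyBounded_singleton {K : Set X} :
    LsBounded K ↔ UniformlyBounded ({K} : Set (Set X)) := by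
  constructor
  · rintro ⟨𝒰, h, -, hK⟩
    refine LsSpace.refine_mem 𝒰 h _ ?_
    rintro B rfl -
    exact ⟨B, hK, Subset.rfl⟩
  · intro h
    obtain ⟨𝒱, h1, h2, h3⟩ := h.exists_cover
    exact ⟨𝒱, h1, h2, h3 rfl⟩

theorem UniformlyBounded.lsBounded_of_mem {𝒰 : Set (Set X)} (h : UniformlyBounded 𝒰) {U : Set X}
    (hU : U ∈ 𝒰) : LsBounded U := by
  obtain ⟨𝒱, h1, h2, h3⟩ := h.exists_cover
  exact ⟨𝒱, h1, h2, h3 hU⟩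

theorem lsBounded_singleton (x : X) : LsBounded ({x} : Set X) := by
  obtain ⟨𝒰, h⟩ := LsSpace.scales_nonempty (X := X)
  refine lsBounded_iff_uniformlyBounded_singleton.2 (LsSpace.refine_mem 𝒰 h _ ?_)
  rintro B rfl hn
  exact absurd hn not_nontrivial_singleton

theorem LsBounded.starOf {K : Set X} (hK : LsBounded K) {𝒰 : Set (Set X)}
    (h : UniformlyBounded 𝒰) : LsBounded (starOf K 𝒰) := by
  rw [lsBounded_iff_uniformlyBounded_singleton] at hK
  exact UniformlyBounded.lsBounded_of_mem (LsSpace.star_mem _ hK _ h) ⟨K, rfl, rfl⟩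

theorem LsBounded.union {K L : Set X} (hK : LsBounded K) (hL : LsBounded L) {x : X} (hxK : x ∈ K)
    (hxL : x ∈ L) : LsBounded (K ∪ L) := by
  obtain ⟨𝒱, h1, h2, h3⟩ := hL
  exact (hK.starOf h1).mono (union_subset (h2.subset_starOf K)
    fun y hy => mem_starOf.2 ⟨L, h3, hy, x, hxK, hxL⟩)

/-- Bounded sets have a bounded union once they share a point; adjoining `x` provides that point in
`WeaklyBounded.union`. -/
theorem WeaklyBounded.insert {K : Set X} (hK : WeaklyBounded K) (x : X) :
    LsBounded (insert x (K ∩ coarseComponent x)) := by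
  rcases (K ∩ coarseComponent x).eq_empty_or_nonempty with h | ⟨y, hyK, M, ⟨hM, hxM⟩, hyM⟩
  · rw [h, insert_empty_eq]
    exact lsBounded_singleton x
  · refine (hM.union (hK x) hyM ⟨hyK, M, ⟨hM, hxM⟩, hyM⟩).mono ?_
    exact insert_subset (Or.inl hxM) subset_union_right

theorem WeaklyBounded.mono {K L : Set X} (hL : WeaklyBounded L) (h : K ⊆ L) : WeaklyBounded K :=
  fun x => (hL x).mono (inter_subset_inter_left _ h)

theorem weaklyBounded_empty : WeaklyBounded (∅ : Set X) := fun x =>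
  (lsBounded_singleton x).mono (by simp)

theorem WeaklyBounded.union {K L : Set X} (hK : WeaklyBounded K) (hL : WeaklyBounded L) :
    WeaklyBounded (K ∪ L) := fun x => by
  refine ((hK.insert x).union (hL.insert x) (mem_insert _ _) (mem_insert _ _)).mono ?_
  rw [union_inter_distrib_right]
  exact union_subset_union (subset_insert _ _) (subset_insert _ _)

theorem WeaklyBounded.starOf {K : Set X} (hK : WeaklyBounded K) {𝒰 : Set (Set X)}
    (h : UniformlyBounded 𝒰) : WeaklyBounded (starOf K 𝒰) := fun x => by
  refine ((hK x).starOf h).mono ?_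
  rintro y ⟨hy, M, ⟨hM, hxM⟩, hyM⟩
  obtain ⟨U, hU, hyU, k, hk, hkU⟩ := mem_starOf.1 hy
  -- `U` meets the component of `x`, so it lies inside it, and so does `k`.
  exact mem_starOf.2 ⟨U, hU, hyU, k,
    ⟨hk, M ∪ U, ⟨hM.union (h.lsBounded_of_mem hU) hyM hyU, Or.inl hxM⟩, Or.inr hkU⟩, hkU⟩

theorem CoarseNhd.exists_weaklyBounded {A N : Set X} (h : CoarseNhd A N) {𝒰 : Set (Set X)}
    (hU : UniformlyBounded 𝒰) : ∃ K : Set X, WeaklyBounded K ∧ starOf A 𝒰 ⊆ N ∪ K := by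
  obtain ⟨𝒱, h1, h2, h3⟩ := hU.exists_cover
  obtain ⟨K, hK, hs⟩ := h.2 𝒱 h1 h2
  exact ⟨K, hK, (starOf_mono Subset.rfl h3).trans hs⟩

theorem CoarseNhd.mono_left {A B N : Set X} (h : CoarseNhd B N) (hAB : A ⊆ B) : CoarseNhd A N :=
  ⟨hAB.trans h.1, fun 𝒰 h1 h2 =>
    (h.2 𝒰 h1 h2).imp fun _ hK => ⟨hK.1, (starOf_mono hAB Subset.rfl).trans hK.2⟩⟩

theorem CoarselySeparated.coarseNhd_compl {A B : Set X} (h : CoarselySeparated A B)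
    (hd : Disjoint A B) : CoarseNhd A Bᶜ := by
  refine ⟨hd.subset_compl_right, fun 𝒰 h1 h2 => ⟨_, h 𝒰 h1, fun x hx => ?_⟩⟩
  by_cases hB : x ∈ B
  · exact Or.inr ⟨hx, h2.subset_starOf B hB⟩
  · exact Or.inl hB

/-- A point of both stars shares a member with some `y ∉ N`. This `y` lies in the double star of
`A`, hence in `K`, so the intersection is contained in a star of `K`. -/
theorem CoarseNhd.coarselySeparated_compl {A N : Set X} (h : CoarseNhd A N) :
    CoarselySeparated A Nᶜ := by
  intro 𝒰 hU
  obtain ⟨𝒱, h1, h2, h3⟩ := hU.exists_cover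
  obtain ⟨K, hK, hs⟩ := h.2 _ (LsSpace.star_mem _ h1 _ h1) (h2.starFamily h2)
  refine (hK.starOf h1).mono ?_
  rintro x ⟨hxA, hxN⟩
  obtain ⟨V, hV, hxV, y, hy, hyV⟩ := mem_starOf.1 hxN
  have : y ∈ starOf A (starFamily 𝒱 𝒱) := starOf_starOf_subset h2 A 𝒱
    (mem_starOf.2 ⟨V, h3 hV, hyV, x, starOf_mono Subset.rfl h3 hxA, hxV⟩)
  exact mem_starOf.2 ⟨V, h3 hV, hxV, y, (hs this).resolve_left hy, hyV⟩

/-- The filter on `X × X` of the sets containing `U × U` for all members `U` of any given uniformly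
bounded family that lie outside some weakly bounded set. -/
def slowOscFilter (X : Type*) [LsSpace X] : Filter (X × X) where
  sets := {E | ∀ 𝒰 : Set (Set X), UniformlyBounded 𝒰 → ∃ K : Set X, WeaklyBounded K ∧
    ∀ U ∈ 𝒰, U ∩ K = ∅ → U ×ˢ U ⊆ E}
  univ_sets _ _ := ⟨∅, weaklyBounded_empty, fun _ _ _ => subset_univ _⟩
  sets_of_superset h hEF 𝒰 hU := (h 𝒰 hU).imp fun _ hK =>
    ⟨hK.1, fun U hU hUK => (hK.2 U hU hUK).trans hEF⟩
  inter_sets h h' 𝒰 hU := by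
    obtain ⟨K, hK, hE⟩ := h 𝒰 hU
    obtain ⟨L, hL, hF⟩ := h' 𝒰 hU
    refine ⟨K ∪ L, hK.union hL, fun U hU hd => ?_⟩
    rw [inter_union_distrib_left, union_empty_iff] at hd
    exact subset_inter (hE U hU hd.1) (hF U hU hd.2)

theorem slowlyOscillating_iff_tendsto {M : Type*} [MetricSpace M] {f : X → M} :
    SlowlyOscillating f ↔ Filter.Tendsto (Prod.map f f) (slowOscFilter X) (uniformity M) := by
  rw [Metric.uniformity_basis_dist.tendsto_right_iff]
  constructor
  · intro h ε hε 𝒰 hU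
    obtain ⟨K, hK, hd⟩ := h 𝒰 hU ε hε
    refine ⟨K, hK, fun U hU hUK p hp => ?_⟩
    have := (Metric.edist_le_ediam_of_mem (mem_image_of_mem f hp.1)
      (mem_image_of_mem f hp.2)).trans_lt (hd U hU hUK)
    rw [edist_dist, ENNReal.ofReal_lt_ofReal_iff hε] at this
    exact this
  · intro h 𝒰 hU ε hε
    -- Pairwise bounds only give `≤` for the diameter; halving `ε` restores strictness.
    obtain ⟨K, hK, hd⟩ := h (ε / 2) (half_pos hε) 𝒰 hU
    refine ⟨K, hK, fun U hU hUK => lt_of_le_of_lt (Metric.ediam_le ?_)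
      ((ENNReal.ofReal_lt_ofReal_iff hε).2 (half_lt_self hε))⟩
    rintro _ ⟨x, hx, rfl⟩ _ ⟨y, hy, rfl⟩
    rw [edist_dist]
    exact ENNReal.ofReal_le_ofReal (le_of_lt (hd U hU hUK (mk_mem_prod hx hy)))

/-- A slowly oscillating real function varies by less than `ε` on stars, off a weakly bounded
set. -/
theorem SlowlyOscillating.exists_weaklyBounded {f : X → ℝ} (hf : SlowlyOscillating f)
    {𝒰 : Set (Set X)} (hU : UniformlyBounded 𝒰) {ε : ℝ} (hε : 0 < ε) :
    ∃ K : Set X, WeaklyBounded K ∧ ∀ U ∈ 𝒰, ∀ x ∈ U, ∀ y ∈ U, x ∉ K → dist (f x) (f y) < ε := by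
  obtain ⟨K, hK, hd⟩ := Metric.uniformity_basis_dist.tendsto_right_iff.1
    (slowlyOscillating_iff_tendsto.1 hf) ε hε 𝒰 hU
  -- One point of `U` outside the star of `K` makes all of `U` miss `K`.
  refine ⟨_, hK.starOf hU, fun U hU x hx y hy hxK => ?_⟩
  refine hd U hU (eq_empty_of_forall_notMem ?_) (mk_mem_prod hx hy)
  rintro z ⟨hzU, hzK⟩
  exact hxK (mem_starOf.2 ⟨U, hU, hx, z, hzK, hzU⟩)

theorem SlowlyOscillating.coarselySeparated {f : X → ℝ} (hf : SlowlyOscillating f) {A B : Set X}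
    (hA : ∀ x ∈ A, f x = 0) (hB : ∀ x ∈ B, f x = 1) : CoarselySeparated A B := by
  intro 𝒰 hU
  obtain ⟨K, hK, hd⟩ := hf.exists_weaklyBounded hU one_half_pos
  refine hK.mono ?_
  rintro x ⟨hxA, hxB⟩
  by_contra hxK
  obtain ⟨U, hU, hxU, a, ha, haU⟩ := mem_starOf.1 hxA
  obtain ⟨V, hV, hxV, b, hb, hbV⟩ := mem_starOf.1 hxB
  have h1 := hd U hU x hxU a haU hxK
  have h2 := hd V hV x hxV b hbV hxK
  rw [hA a ha, Real.dist_eq, abs_lt] at h1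
  rw [hB b hb, Real.dist_eq, abs_lt] at h2
  linarith [h1.2, h2.1]

theorem SlowlyOscillating.coarseNhd {f : X → ℝ} (hf : SlowlyOscillating f) {A N : Set X} {s t : ℝ}
    (hst : s < t) (hA : ∀ x ∈ A, f x ≤ s) (hN : ∀ x, f x < t → x ∈ N) : CoarseNhd A N := by
  refine ⟨fun x hx => hN x ((hA x hx).trans_lt hst), fun 𝒰 hU _ => ?_⟩
  obtain ⟨K, hK, hd⟩ := hf.exists_weaklyBounded hU (sub_pos.2 hst)
  refine ⟨K, hK, fun x hx => or_iff_not_imp_right.2 fun hxK => hN x ?_⟩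
  obtain ⟨U, hU, hxU, a, ha, haU⟩ := mem_starOf.1 hx
  have h1 := hd U hU x hxU a haU hxK
  rw [Real.dist_eq, abs_lt] at h1
  linarith [h1.2, hA a ha]

end LargeScaleLemmas

/-! ### Urysohn functions and the Higson compactification. -/

section Hybrid

variable {X : Type*} [TopologicalSpace X] [LsSpace X]

/-- The open scale links topology and coarse structure: a point outside `interior N` is in the
closure of `Nᶜ`, hence in a member of that scale meeting `Nᶜ`. -/
theorem CoarseNhd.interior [HlsSpace X] {A N : Set X} (h : CoarseNhd A N)
    (hA : A ⊆ interior N) : CoarseNhd A (interior N) := by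
  obtain ⟨𝒱, hV, hcov, hopen⟩ := HlsSpace.exists_open_scale (X := X)
  refine ⟨hA, fun 𝒰 h1 h2 => ?_⟩
  obtain ⟨K, hK, hs⟩ := h.2 _ (LsSpace.star_mem _ h1 _ hV) (h2.starFamily hcov)
  refine ⟨_, hK.starOf hV, fun x hx => or_iff_not_imp_left.2 fun hxN => ?_⟩
  rw [← mem_compl_iff, ← closure_compl] at hxN
  obtain ⟨V, hV', hxV, y, hy, hyV⟩ := mem_starOf.1 (closure_subset_starOf hcov hopen _ hxN)
  have : y ∈ starOf A (starFamily 𝒰 𝒱) := starOf_starOf_subset hcov A 𝒰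
    (mem_starOf.2 ⟨V, hV', hyV, x, hx, hxV⟩)
  exact mem_starOf.2 ⟨V, hV', hxV, y, (hs this).resolve_left hy, hyV⟩

/-- This is the interpolation property demanded by the field `hP` of `Urysohns.CU`. -/
theorem HlsNormal.exists_isOpen_coarseNhd [HlsSpace X] (h : HlsNormal X) {C U : Set X}
    (hC : IsClosed C) (hP : CoarseNhd C U) (hU : IsOpen U) (hCU : C ⊆ U) :
    ∃ V : Set X, IsOpen V ∧ C ⊆ V ∧ closure V ⊆ U ∧ CoarseNhd C V ∧ CoarseNhd (closure V) U := by
  obtain ⟨V, hV, ⟨hCV, hCV'⟩, -, hVU⟩ :=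
    h C U hC ⟨⟨U, hU, hC.closure_eq.symm ▸ hCU, Subset.rfl⟩, hP⟩
  have h1 : C ⊆ interior V := subset_closure.trans hCV.closure_subset_interior
  have h2 : closure (interior V) ⊆ V := hV.closure_interior_subset
  exact ⟨interior V, isOpen_interior, h1, h2.trans hVU.1, hCV'.interior h1, hVU.mono_left h2⟩

/-- A coarse form of `Urysohns.CU.continuous_lim`. -/
theorem Urysohns.CU.slowlyOscillating_lim (c : Urysohns.CU (CoarseNhd (X := X))) :
    SlowlyOscillating c.lim := by
  have h0 : (2⁻¹ : ℝ) < 3 / 4 := by norm_num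
  rw [slowlyOscillating_iff_tendsto]
  refine (Metric.uniformity_basis_dist_le_pow (r := 3 / 4) (by norm_num)
    (by norm_num)).tendsto_right_iff.2 fun n _ => ?_
  induction n generalizing c with
  | zero =>
    refine Filter.Eventually.of_forall fun p => ?_
    simpa using Real.dist_le_of_mem_Icc_01 (c.lim_mem_Icc p.1) (c.lim_mem_Icc p.2)
  | succ n ihn =>
    -- `c.left.right` has outer set `c.left.U`, so off a weakly bounded set a member meeting its
    -- inner set stays in `c.left.U`.
    have key : ∀ᶠ p : X × X in slowOscFilter X,
        (p.1 ∈ c.left.U ∧ p.2 ∈ c.left.U) ∨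
          (p.1 ∉ c.left.right.C ∧ p.2 ∉ c.left.right.C) := by
      intro 𝒰 hU
      obtain ⟨K, hK, hs⟩ := c.left.right.P_C_U.exists_weaklyBounded hU
      refine ⟨K, hK, fun U hU hUK => ?_⟩
      by_cases hm : ∃ z ∈ c.left.right.C, z ∈ U
      · have hsub : U ⊆ c.left.U := fun x hx =>
          (hs (mem_starOf.2 ⟨U, hU, hx, hm⟩)).resolve_right fun hxK =>
            (hUK ▸ (⟨hx, hxK⟩ : x ∈ U ∩ K) : x ∈ (∅ : Set X))
        exact fun p hp => Or.inl ⟨hsub hp.1, hsub hp.2⟩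
      · push Not at hm
        exact fun p hp => Or.inr ⟨fun h => hm _ h hp.1, fun h => hm _ h hp.2⟩
    filter_upwards [key, ihn c.left, ihn c.left.right, ihn c.right] with p hp hl hlr hr
    obtain ⟨x, y⟩ := p
    simp only [Prod.map_apply] at hp hl hlr hr ⊢
    rcases hp with ⟨hx, hy⟩ | ⟨hx, hy⟩
    -- Here the right half vanishes at both points, so the bound is halved.
    · rw [pow_succ', c.lim_eq_midpoint, c.lim_eq_midpoint,
        c.right.lim_of_mem_C _ (c.left_U_subset_right_C hx),
        c.right.lim_of_mem_C _ (c.left_U_subset_right_C hy)]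
      refine (dist_midpoint_midpoint_le _ _ _ _).trans ?_
      rw [dist_self, add_zero, div_eq_inv_mul]
      gcongr
    -- Here `c.left.left.lim` is 1 at both points, so the left half varies by at most `r / 2`;
    -- averaging with `r` from the right half gives the ratio `3 / 4`.
    · replace hx : x ∉ c.left.left.U := fun h => hx (c.left.left_U_subset_right_C h)
      replace hy : y ∉ c.left.left.U := fun h => hy (c.left.left_U_subset_right_C h)
      simp only [pow_succ, c.lim_eq_midpoint, c.left.lim_eq_midpoint,
        c.left.left.lim_of_notMem_U _ hx, c.left.left.lim_of_notMem_U _ hy]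
      grw [dist_midpoint_midpoint_le, dist_midpoint_midpoint_le, dist_self, zero_add]
      set r := (3 / 4 : ℝ) ^ n
      calc _ ≤ (r / 2 + r) / 2 := by gcongr
        _ = _ := by ring

theorem HlsNormal.exists_slowlyOscillating [HlsSpace X] (h : HlsNormal X) {A B : Set X}
    (hA : IsClosed A) (hB : IsClosed B) (hd : Disjoint A B) (hs : CoarselySeparated A B) :
    ∃ f : HigsonFun X, (∀ x ∈ A, f.1 x = 0) ∧ ∀ x ∈ B, f.1 x = 1 := by
  let c : Urysohns.CU (CoarseNhd (X := X)) :=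
    { C := A
      U := Bᶜ
      P_C_U := hs.coarseNhd_compl hd
      closed_C := hA
      open_U := hB.isOpen_compl
      subset := hd.subset_compl_right
      hP := fun hC hP hU hCU => h.exists_isOpen_coarseNhd hC hP hU hCU }
  refine ⟨⟨fun x => ⟨c.lim x, c.lim_mem_Icc x⟩, c.continuous_lim.subtype_mk _,
    slowlyOscillating_iff_tendsto.2 ?_⟩, fun x hx => Subtype.ext (c.lim_of_mem_C x hx),
    fun x hx => Subtype.ext (c.lim_of_notMem_U x (not_not.2 hx))⟩
  rw [uniformity_subtype, Filter.tendsto_comap_iff]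
  exact slowlyOscillating_iff_tendsto.1 c.slowlyOscillating_lim

theorem continuous_toHigson : Continuous (toHigson (X := X)) :=
  Continuous.subtype_mk (continuous_pi fun f => f.2.1) _

/-- The uniformity of the cube is the infimum over its coordinates, each of which is slowly
oscillating on `X`. -/
theorem tendsto_prodMap_toHigson : Filter.Tendsto (Prod.map (toHigson (X := X)) toHigson)
    (slowOscFilter X) (uniformity (HigsonCompactification X)) := by
  rw [uniformity_subtype, Filter.tendsto_comap_iff, Pi.uniformity, Filter.tendsto_iInf]
  intro f
  rw [Filter.tendsto_comap_iff]
  exact slowlyOscillating_iff_tendsto.1 f.2.2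

theorem slowlyOscillating_comp_toHigson {g : HigsonCompactification X → ℝ} (hg : Continuous g) :
    SlowlyOscillating (g ∘ toHigson) :=
  slowlyOscillating_iff_tendsto.2
    (Filter.Tendsto.comp (CompactSpace.uniformContinuous_of_continuous hg) tendsto_prodMap_toHigson)

theorem exists_slowlyOscillating_of_disjoint_closure {A B : Set X}
    (h : closure (toHigson '' A) ∩ closure (toHigson '' B) = ∅) :
    ∃ f : X → ℝ, Continuous f ∧ SlowlyOscillating f ∧ (∀ x ∈ A, f x = 0) ∧ ∀ x ∈ B, f x = 1 := by
  obtain ⟨g, hgA, hgB, -⟩ := exists_continuous_zero_one_of_isClosed isClosed_closure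
    isClosed_closure (disjoint_iff_inter_eq_empty.2 h)
  exact ⟨g ∘ toHigson, g.continuous.comp continuous_toHigson,
    slowlyOscillating_comp_toHigson g.continuous,
    fun x hx => hgA (subset_closure (mem_image_of_mem _ hx)),
    fun x hx => hgB (subset_closure (mem_image_of_mem _ hx))⟩

theorem disjoint_closure_of_higsonFun {A B : Set X} (f : HigsonFun X) (hA : ∀ x ∈ A, f.1 x = 0)
    (hB : ∀ x ∈ B, f.1 x = 1) :
    closure (toHigson '' A) ∩ closure (toHigson '' B) = ∅ := by
  have hc : Continuous fun z : HigsonCompactification X => z.1 f :=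
    (continuous_apply f).comp continuous_subtype_val
  have h0 : closure (toHigson '' A) ⊆ {z | z.1 f = 0} :=
    closure_minimal (image_subset_iff.2 hA) (isClosed_eq hc continuous_const)
  have h1 : closure (toHigson '' B) ⊆ {z | z.1 f = 1} :=
    closure_minimal (image_subset_iff.2 hB) (isClosed_eq hc continuous_const)
  refine eq_empty_of_forall_notMem fun z hz => ?_
  exact zero_ne_one ((h0 hz.1).symm.trans (h1 hz.2))

theorem hlsNormal_of_exists_slowlyOscillating [HlsSpace X]
    (h : ∀ A B : Set X, IsClosed A → IsClosed B → Disjoint A B → CoarselySeparated A B →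
      ∃ f : X → ℝ, Continuous f ∧ SlowlyOscillating f ∧ (∀ x ∈ A, f x = 0) ∧ ∀ x ∈ B, f x = 1) :
    HlsNormal X := by
  rintro A N hA ⟨hT, hN⟩
  have hAN : A ⊆ interior N := subset_closure.trans hT.closure_subset_interior
  -- `N` need not be open, so its interior is used to get a closed complement; it is still a coarse
  -- neighbourhood of `A`.
  obtain ⟨f, hf, hso, hfA, hfB⟩ := h A (interior N)ᶜ hA isOpen_interior.isClosed_compl
    (disjoint_compl_right_iff_subset.2 hAN) (hN.interior hAN).coarselySeparated_compl
  have hfN : ∀ x, f x < 1 → x ∈ interior N := fun x hx => by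
    by_contra hxN
    exact hx.ne (hfB x hxN)
  have hV : IsClosed {x | f x ≤ 1 / 2} := isClosed_le hf continuous_const
  refine ⟨{x | f x ≤ 1 / 2}, hV, ⟨⟨{x | f x < 1 / 2}, isOpen_lt hf continuous_const, ?_,
    ofPred_subset_ofPred_of_imp fun x hx => le_of_lt hx⟩, hso.coarseNhd one_half_pos (fun x hx => (hfA x hx).le)
    fun x hx => le_of_lt hx⟩, ⟨interior N, isOpen_interior, ?_, interior_subset⟩,
    hso.coarseNhd one_half_lt_one (fun x hx => hx) fun x hx => interior_subset (hfN x hx)⟩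
  · rw [hA.closure_eq]
    intro x hx
    rw [mem_ofPred_eq, hfA x hx]
    exact one_half_pos
  · rw [hV.closure_eq]
    exact fun x hx => hfN x (lt_of_le_of_lt hx one_half_lt_one)

end Hybrid

theorem mainTheorem10 (X : Type*) [TopologicalSpace X] [T35Space X] [LsSpace X] [HlsSpace X] :
    HlsNormal X ↔
      ∀ A B : Set X, IsClosed A → IsClosed B → Disjoint A B →
        (CoarselySeparated A B ↔
          closure (toHigson '' A) ∩ closure (toHigson '' B) = ∅) := by
  constructor
  · refine fun h A B hA hB hd => ⟨fun hs => ?_, fun hcl => ?_⟩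
    · obtain ⟨f, hfA, hfB⟩ := h.exists_slowlyOscillating hA hB hd hs
      exact disjoint_closure_of_higsonFun f hfA hfB
    · obtain ⟨f, -, hso, hfA, hfB⟩ := exists_slowlyOscillating_of_disjoint_closure hcl
      exact hso.coarselySeparated hfA hfB
  · exact fun h => hlsNormal_of_exists_slowlyOscillating fun A B hA hB hd hs =>
      exists_slowlyOscillating_of_disjoint_closure ((h A B hA hB hd).1 hs)
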